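/- Let $m_0,m_1,m_2\in\mathbb R^2$ be three receivers with $\det(m_1-m_0,\;m_2-m_0)>0$ (so they are not collinear and are labelled counterclockwise). For $x\in\mathbb R^2$ put $d_i(x)=x-m_i$ and, for $x\ne m_i$, $\tilde d_i(x)=d_i(x)/\|d_i(x)\|$ (Euclidean norm); for $v,w\in\mathbb R^2$ write $[v,w]=v_1w_2-v_2w_1$. The reduced TDOA map is $$\tau_2:\mathbb R^2\to\mathbb R^2,\qquad \tau_2(x)=\bigl(\|d_1(x)\|-\|d_0(x)\|,\ \|d_2(x)\|-\|d_0(x)\|\bigr).$$ Define $$\Omega=\{x\in\mathbb R^2\setminus\{m_0,m_1,m_2\}:\ [\tilde d_1(x),\tilde d_0(x)]-[\tilde d_2(x),\tilde d_0(x)]+[\tilde d_2(x),\tilde d_1(x)]<0\},$$ $$\Omega_0=\{x:[d_1(x),d_0(x)]>0,\ [d_2(x),d_0(x)]<0\},$$ $$\Omega_1=\{x:[d_1(x),d_0(x)]>0,\ [d_2(x),d_1(x)]>0\},$$ $$\Omega_2=\{x:[d_2(x),d_0(x)]<0,\ [d_2(x),d_1(x)]>0\}.$$ Let $\Sigma_2$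 be a symmetric positive definite real $2\times2$ matrix. The reduced Gaussian TDOA model is $\hat\tau_2(x)=\tau_2(x)+\varepsilon_2$ with $\varepsilon_2\sim N(0,\Sigma_2)$; that is, a source at $x$ produces measurements with density $p(\,\cdot\,;\tau_2(x),\Sigma_2)$, where $$p(y;\nu,\Sigma_2)=\frac1{2\pi\sqrt{\det\Sigma_2}}\exp\Bigl[-\tfrac12(y-\nu)^T\Sigma_2^{-1}(y-\nu)\Bigr],\qquad y,\nu\in\mathbb R^2 .$$ Definitions. An $n$-dimensional exponential family on a space $\mathcal X$ with a reference measure is a set $S$ of probability densities $p(y;\theta)=\exp[C(y)+\sum_{i=1}^n\theta_iF_i(y)-\psi(\theta)]$, $\theta\in\Theta$, where $\Theta\subseteq\mathbb R^n$ is open, $C,F_1,\dots,F_n:\mathcal X\to\mathbb R$, $\psi\in C^\infty(\Theta)$, and $\theta$ is determined by $p(\,\cdot\,;\theta)$; $S$ is a smooth manifold with global coordinate system $p(\,\cdot\,;\theta)\mapsto\theta$. An $(n,m)$ curved exponential family in $S$ is a subset $M\subseteq S$ that is an (embedded) smooth $m$-dimensional submanifold of $S$. Theorem. The densities $p(\,\cdot\,;\theta,\Sigma_2)$,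 $\theta\in\Theta=\mathbb R^2$, are the members $p(\,\cdot\,;\theta)$ of a $2$-dimensional exponential family $S$ on $\mathbb R^2$ (with Lebesgue measure). For each $W\in\{\Omega,\Omega_0,\Omega_1,\Omega_2\}$ the restricted model $M_W=\{p(\,\cdot\,;\tau_2(x),\Sigma_2):x\in W\}$ is a $(2,2)$ curved exponential family in $S$, and it is parameterized by $\theta(x)=\tau_2(x)$, $x\in W$: the set $W$ is open, the density at $x\in W$ is the member of $S$ with parameter $\tau_2(x)$, and $\tau_2|_W:W\to\mathbb R^2$ is a smooth embedding ($C^\infty$, with injective differential at every point, and a homeomorphism onto its image). -/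

import Mathlib

open scoped ContDiff Matrix

noncomputable section

namespace TDOA

/-- `ℝⁿ` with its Euclidean norm. -/
abbrev E (n : ℕ) : Type := EuclideanSpace ℝ (Fin n)

/-! ### Exponential families and curved exponential families -/

/-- The function `y ↦ exp (C y + ∑ i, θ i * F i y - ψ θ)`. -/
def expDensity {X : Type*} {n : ℕ} (C : X → ℝ) (F : Fin n → X → ℝ) (ψ : E n → ℝ)
    (θ : E n) (y : X) : ℝ :=
  Real.exp (C y + ∑ i, θ i * F i y - ψ θ)

/-- An `n`-dimensional exponential family on `X`: its members are the functions
`expDensity C F ψ θ`, for `θ` in an open set `Θ ⊆ ℝⁿ`; they are probability densities with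
respect to the reference measure `μ`, and the parameter is determined by the density, so that
`p(·; θ) ↦ θ` is a global coordinate system of the family. -/
structure ExponentialFamily (X : Type*) [MeasurableSpace X] (μ : MeasureTheory.Measure X)
    (n : ℕ) where
  /-- the parameter space -/
  Θ : Set (E n)
  C : X → ℝ
  F : Fin n → X → ℝ
  ψ : E n → ℝ
  isOpen_Θ : IsOpen Θ
  contDiffOn_ψ : ContDiffOn ℝ ∞ ψ Θ
  integrable_density : ∀ θ ∈ Θ, MeasureTheory.Integrable (expDensity C F ψ θ) μ
  integral_density : ∀ θ ∈ Θ, ∫ y, expDensity C F ψ θ y ∂μ = 1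
  injOn_density : Set.InjOn (expDensity C F ψ) Θ

/-- `N` is an (embedded) smooth `m`-dimensional submanifold of `ℝⁿ`: around each of its points
there is a smooth chart of `ℝⁿ` in which `N` is given by the vanishing of the last `n - m`
coordinates. -/
def IsSmoothSubmanifold {n : ℕ} (m : ℕ) (N : Set (E n)) : Prop :=
  m ≤ n ∧ ∀ z ∈ N, ∃ e : OpenPartialHomeomorph (E n) (E n),
    z ∈ e.source ∧ ContDiffOn ℝ ∞ e e.source ∧ ContDiffOn ℝ ∞ e.symm e.target ∧
      ∀ w ∈ e.source, w ∈ N ↔ ∀ i : Fin n, m ≤ (i : ℕ) → e w i = 0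

/-- `θ` restricts to a smooth embedding of the open set `W ⊆ ℝᵐ` into `ℝⁿ`. -/
structure IsSmoothEmbeddingOn {m n : ℕ} (θ : E m → E n) (W : Set (E m)) : Prop where
  isOpen : IsOpen W
  contDiffOn : ContDiffOn ℝ ∞ θ W
  injective_fderiv : ∀ x ∈ W, Function.Injective (fderiv ℝ θ x)
  isEmbedding : Topology.IsEmbedding (fun x : W => θ x)

namespace ExponentialFamily

variable {X : Type*} [MeasurableSpace X] {μ : MeasureTheory.Measure X} {n : ℕ}

/-- The density `p(·; θ)`. -/
def density (S : ExponentialFamily X μ n) (θ : E n) : X → ℝ :=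
  expDensity S.C S.F S.ψ θ

/-- The set of densities that make up the family. -/
def carrier (S : ExponentialFamily X μ n) : Set (X → ℝ) :=
  S.density '' S.Θ

/-- The set `M` of densities is an `(n, m)` curved exponential family within `S`: a smooth
`m`-dimensional submanifold of `S`, where `S` carries the differentiable structure of its
global coordinate system `p(·; θ) ↦ θ`. -/
def IsCurvedExponentialFamily (S : ExponentialFamily X μ n) (m : ℕ) (M : Set (X → ℝ)) : Prop :=
  M ⊆ S.carrier ∧ IsSmoothSubmanifold m {θ : E n | θ ∈ S.Θ ∧ S.density θ ∈ M}

/-- The densities `p x`, `x ∈ W`, are members of `S` whose parameter is `θ x`, and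
`θ` embeds the open set `W` smoothly into the parameter space. -/
def IsParametrizedBy (S : ExponentialFamily X μ n) {m : ℕ} (W : Set (E m)) (p : E m → X → ℝ)
    (θ : E m → E n) : Prop :=
  (∀ x ∈ W, θ x ∈ S.Θ ∧ p x = S.density (θ x)) ∧ IsSmoothEmbeddingOn θ W

end ExponentialFamily

/-! ### The TDOA model for three receivers `r 0`, `r 1`, `r 2` in the plane -/

/-- `∗(v ∧ w)`, the determinant of the matrix with columns `v`, `w`. -/
def wedge (v w : E 2) : ℝ := v 0 * w 1 - v 1 * w 0

/-- The displacement vector of the source `x` from the receiver `i`. -/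
def disp (r : Fin 3 → E 2) (i : Fin 3) (x : E 2) : E 2 := x - r i

/-- The unit displacement vector (meaningful when `x` is not the receiver `i`). -/
def unitDisp (r : Fin 3 → E 2) (i : Fin 3) (x : E 2) : E 2 :=
  ‖disp r i x‖⁻¹ • disp r i x

/-- The reduced TDOA map `τ₂`. -/
def tau (r : Fin 3 → E 2) (x : E 2) : E 2 :=
  !₂[‖disp r 1 x‖ - ‖disp r 0 x‖, ‖disp r 2 x‖ - ‖disp r 0 x‖]

/-- The region `Ω`. The receivers, where the unit vectors are undefined, do not belong to it. -/
def Omega (r : Fin 3 → E 2) : Set (E 2) :=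
  {x | (∀ i, x ≠ r i) ∧
    wedge (unitDisp r 1 x) (unitDisp r 0 x) - wedge (unitDisp r 2 x) (unitDisp r 0 x)
      + wedge (unitDisp r 2 x) (unitDisp r 1 x) < 0}

/-- The region `Ω₀`. -/
def Omega0 (r : Fin 3 → E 2) : Set (E 2) :=
  {x | 0 < wedge (disp r 1 x) (disp r 0 x) ∧ wedge (disp r 2 x) (disp r 0 x) < 0}

/-- The region `Ω₁`. -/
def Omega1 (r : Fin 3 → E 2) : Set (E 2) :=
  {x | 0 < wedge (disp r 1 x) (disp r 0 x) ∧ 0 < wedge (disp r 2 x) (disp r 1 x)}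

/-- The region `Ω₂`. -/
def Omega2 (r : Fin 3 → E 2) : Set (E 2) :=
  {x | wedge (disp r 2 x) (disp r 0 x) < 0 ∧ 0 < wedge (disp r 2 x) (disp r 1 x)}

/-- The density of the bivariate normal distribution `N(ν, K)`. -/
def normalDensity (K : Matrix (Fin 2) (Fin 2) ℝ) (ν y : E 2) : ℝ :=
  1 / (2 * Real.pi * √K.det) *
    Real.exp (-(1 / 2) * ((y - ν).ofLp ⬝ᵥ (K⁻¹ *ᵥ (y - ν).ofLp)))

/-- The reduced Gaussian TDOA model `τ₂(x) + ε`, `ε ∼ N(0, K)`: the density of the measurement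
when the source is at `x`. -/
def modelDensity (r : Fin 3 → E 2) (K : Matrix (Fin 2) (Fin 2) ℝ) (x : E 2) : E 2 → ℝ :=
  normalDensity K (tau r x)

/-- The restriction of the model to sources in `W`, as a set of probability densities. -/
def restrictedModel (r : Fin 3 → E 2) (K : Matrix (Fin 2) (Fin 2) ℝ) (W : Set (E 2)) :
    Set (E 2 → ℝ) :=
  modelDensity r K '' W

end TDOA

end

/-! With fixed covariance, expanding the square in the Gaussian exponent leaves a cross term linear
in the mean. The Gaussians therefore form an exponential family with the mean as global coordinate,
and everything reduces to `tau` being an open embedding on each region.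

Local part: `orient` is minus the Jacobian, so where it does not vanish the inverse function theorem
applies.

Global part (`eq_of_tau_eq`): if `tau` agrees at `x` and `y`, the three distances differ by one
common shift `s`. Differences of the circle equations are linear, so the pairs (point, shift) lie on
a line. The remaining circle equation restricts to a polynomial of degree at most two on it, whose
derivative at a root is, up to a common factor, `orient` times the product of the distances. At two
distinct roots these derivatives are opposite, so a constant sign of `orient` forces injectivity.

The sign is negative on `Omega` by definition. On the other three regions it is positive, by sin (α
+ β) < sin α + sin β. -/

open scoped ContDiff Matrix

noncomputable section

namespace TDOA

/-! ### The Gaussian exponential family -/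

/-- The quadratic form of the matrix `P`. -/
def quadForm (P : Matrix (Fin 2) (Fin 2) ℝ) (v : E 2) : ℝ := v.ofLp ⬝ᵥ (P *ᵥ v.ofLp)

theorem quadForm_pos {P : Matrix (Fin 2) (Fin 2) ℝ} (hP : P.PosDef) {v : E 2} (hv : v ≠ 0) :
    0 < quadForm P v := by
  have := hP.dotProduct_mulVec_pos (x := v.ofLp) (by simpa using hv)
  simpa [quadForm] using this

theorem quadForm_sub {P : Matrix (Fin 2) (Fin 2) ℝ} (hP : P.IsHermitian) (y ν : E 2) :
    quadForm P (y - ν) =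
      quadForm P y + quadForm P ν - 2 * (ν.ofLp ⬝ᵥ (P *ᵥ y.ofLp)) := by
  have h : P 1 0 = P 0 1 := by simpa using hP.apply 0 1
  simp only [quadForm, Matrix.mulVec, dotProduct, Fin.sum_univ_two, PiLp.sub_apply, h]
  ring

theorem contDiff_quadForm (P : Matrix (Fin 2) (Fin 2) ℝ) : ContDiff ℝ ∞ (quadForm P) := by
  unfold quadForm
  simp only [Matrix.mulVec, dotProduct, Fin.sum_univ_two]
  fun_prop

theorem map_toLpLin_volume {B : Matrix (Fin 2) (Fin 2) ℝ} (hB : B.det ≠ 0) :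
    MeasureTheory.Measure.map (B.toLpLin 2 2) (MeasureTheory.volume : MeasureTheory.Measure (E 2)) =
      ENNReal.ofReal |B.det⁻¹| • MeasureTheory.volume := by
  have := MeasureTheory.Measure.map_linearMap_addHaar_eq_smul_addHaar
    (MeasureTheory.volume : MeasureTheory.Measure (E 2)) (f := B.toLpLin 2 2)
    (by rwa [LinearMap.det_toLpLin])
  rwa [LinearMap.det_toLpLin] at this

theorem measurableEmbedding_toLpLin {B : Matrix (Fin 2) (Fin 2) ℝ} (hB : B.det ≠ 0) :
    MeasurableEmbedding (B.toLpLin 2 2) := by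
  have hinj : LinearMap.ker (B.toLpLin 2 2) = ⊥ := by
    by_contra h
    exact hB (by rw [← LinearMap.det_toLpLin 2]; exact LinearMap.det_eq_zero_iff_ker_ne_bot.2 h)
  exact (LinearMap.isClosedEmbedding_of_injective hinj).measurableEmbedding

/-- The integral of a non-integrable function is 0 by convention, whereas the known value here is
positive. -/
theorem integrable_exp_neg_half_norm_sq :
    MeasureTheory.Integrable (fun v : E 2 => Real.exp (-(1 / 2) * ‖v‖ ^ 2)) := by
  by_contra h
  have h1 := GaussianFourier.integral_rexp_neg_mul_sq_norm (V := E 2) (b := 1 / 2) (by norm_num)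
  rw [MeasureTheory.integral_undef h] at h1
  exact absurd h1 (by positivity)

-- Positivity gives a factorization P = BᵀB. The linear substitution `B` then reduces the Gaussian
-- integral to the standard one.
open scoped MatrixOrder Matrix.Norms.L2Operator in
theorem exists_quadForm_eq_norm_sq {P : Matrix (Fin 2) (Fin 2) ℝ} (hP : P.PosDef) :
    ∃ B : Matrix (Fin 2) (Fin 2) ℝ, B.det ^ 2 = P.det ∧
      ∀ v : E 2, quadForm P v = ‖B.toLpLin 2 2 v‖ ^ 2 := by
  obtain ⟨B, rfl⟩ : ∃ B : Matrix (Fin 2) (Fin 2) ℝ, P = B.conjTranspose * B :=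
    CStarAlgebra.nonneg_iff_eq_star_mul_self.1 hP.posSemidef.nonneg
  refine ⟨B, by simp [pow_two], fun v => ?_⟩
  rw [EuclideanSpace.norm_sq_eq]
  simp [quadForm, Matrix.mulVec, dotProduct, Fin.sum_univ_two, Matrix.mul_apply]
  ring

theorem integrable_and_integral_exp_quadForm {P : Matrix (Fin 2) (Fin 2) ℝ} (hP : P.PosDef) :
    MeasureTheory.Integrable (fun v : E 2 => Real.exp (-(1 / 2) * quadForm P v)) ∧
    ∫ v : E 2, Real.exp (-(1 / 2) * quadForm P v) = 2 * Real.pi / √P.det := by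
  obtain ⟨B, hdet, hB⟩ := exists_quadForm_eq_norm_sq hP
  have hB0 : B.det ≠ 0 := by
    intro h
    have := hP.det_pos
    simp [← hdet, h] at this
  have hm := measurableEmbedding_toLpLin hB0
  have hmap := map_toLpLin_volume hB0
  simp only [hB]
  constructor
  · refine (hm.integrable_map_iff (g := fun v : E 2 => Real.exp (-(1 / 2) * ‖v‖ ^ 2))).1 ?_
    rw [hmap]
    exact integrable_exp_neg_half_norm_sq.smul_measure ENNReal.ofReal_ne_top
  · have h := hm.integral_map (μ := MeasureTheory.volume)
      (fun v : E 2 => Real.exp (-(1 / 2) * ‖v‖ ^ 2))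
    rw [← h, hmap, MeasureTheory.integral_smul_measure,
      GaussianFourier.integral_rexp_neg_mul_sq_norm (by norm_num), ← hdet, Real.sqrt_sq_eq_abs]
    simp
    field_simp

theorem normalDensity_eq (K : Matrix (Fin 2) (Fin 2) ℝ) (ν y : E 2) :
    normalDensity K ν y =
      1 / (2 * Real.pi * √K.det) * Real.exp (-(1 / 2) * quadForm K⁻¹ (y - ν)) := rfl

theorem expDensity_eq_normalDensity {K : Matrix (Fin 2) (Fin 2) ℝ} (hK : K.PosDef) (θ : E 2) :
    expDensity
      (fun y : E 2 => Real.log (1 / (2 * Real.pi * √K.det)) - 1 / 2 * quadForm K⁻¹ y)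
      (fun i y => (K⁻¹ *ᵥ y.ofLp) i) (fun θ => 1 / 2 * quadForm K⁻¹ θ) θ =
      normalDensity K θ := by
  have hc : 0 < 1 / (2 * Real.pi * √K.det) := by
    have := hK.det_pos
    positivity
  funext y
  rw [normalDensity_eq, quadForm_sub hK.inv.isHermitian, expDensity]
  conv_rhs => rw [← Real.exp_log hc, ← Real.exp_add]
  congr 1
  simp only [dotProduct]
  ring

theorem integrable_normalDensity {K : Matrix (Fin 2) (Fin 2) ℝ} (hK : K.PosDef) (θ : E 2) :
    MeasureTheory.Integrable (normalDensity K θ) :=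
  ((integrable_and_integral_exp_quadForm hK.inv).1.comp_sub_right θ).const_mul _

theorem integral_normalDensity {K : Matrix (Fin 2) (Fin 2) ℝ} (hK : K.PosDef) (θ : E 2) :
    ∫ y, normalDensity K θ y = 1 := by
  simp only [normalDensity_eq]
  rw [MeasureTheory.integral_const_mul,
    MeasureTheory.integral_sub_right_eq_self
      (fun v : E 2 => Real.exp (-(1 / 2) * quadForm K⁻¹ v)) θ,
    (integrable_and_integral_exp_quadForm hK.inv).2, Matrix.det_nonsing_inv,
    Ring.inverse_eq_inv', Real.sqrt_inv]
  have := hK.det_pos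
  field_simp

/-- A Gaussian attains its maximum only at its mean, so it suffices to compare both densities at
`θ`. -/
theorem normalDensity_injective {K : Matrix (Fin 2) (Fin 2) ℝ} (hK : K.PosDef) :
    Function.Injective (normalDensity K) := by
  intro θ θ' h
  by_contra hne
  have hc : 1 / (2 * Real.pi * √K.det) ≠ 0 := by
    have := hK.det_pos
    positivity
  have h1 := congrFun h θ
  rw [normalDensity_eq, normalDensity_eq, mul_right_inj' hc, Real.exp_eq_exp] at h1
  have h2 := quadForm_pos hK.inv (sub_ne_zero.2 hne)
  have h3 : quadForm K⁻¹ (θ - θ) = 0 := by simp [quadForm]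
  linarith

/-- The exponential family of the bivariate normal distributions with covariance matrix `K`,
parametrized by the mean. -/
def normalFamily {K : Matrix (Fin 2) (Fin 2) ℝ} (hK : K.PosDef) :
    ExponentialFamily (E 2) MeasureTheory.volume 2 where
  Θ := Set.univ
  C y := Real.log (1 / (2 * Real.pi * √K.det)) - 1 / 2 * quadForm K⁻¹ y
  F i y := (K⁻¹ *ᵥ y.ofLp) i
  ψ θ := 1 / 2 * quadForm K⁻¹ θ
  isOpen_Θ := isOpen_univ
  contDiffOn_ψ := (contDiff_const.mul (contDiff_quadForm _)).contDiffOn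
  integrable_density θ _ := by
    rw [expDensity_eq_normalDensity hK]
    exact integrable_normalDensity hK θ
  integral_density θ _ := by
    rw [expDensity_eq_normalDensity hK]
    exact integral_normalDensity hK θ
  injOn_density θ _ θ' _ h := by
    rw [expDensity_eq_normalDensity hK, expDensity_eq_normalDensity hK] at h
    exact normalDensity_injective hK h

theorem normalFamily_density {K : Matrix (Fin 2) (Fin 2) ℝ} (hK : K.PosDef) (θ : E 2) :
    (normalFamily hK).density θ = normalDensity K θ :=
  expDensity_eq_normalDensity hK θ

/-! ### Open smooth embeddings -/

/-- The identity chart on `N` works: in codimension 0 no coordinate is required to vanish. -/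
theorem isSmoothSubmanifold_of_isOpen {n : ℕ} {N : Set (E n)} (hN : IsOpen N) :
    IsSmoothSubmanifold n N := by
  refine ⟨le_rfl, fun z hz => ⟨OpenPartialHomeomorph.ofSet N hN, hz, contDiffOn_id,
    contDiffOn_id, fun w hw => ⟨fun _ i hi => absurd i.2 (not_lt.2 hi), fun _ => hw⟩⟩⟩

theorem isOpenMap_restrict_of_injective_fderiv {n : ℕ} {f : E n → E n} {W : Set (E n)}
    (hW : IsOpen W) (hf : ContDiffOn ℝ ∞ f W)
    (hinj : ∀ x ∈ W, Function.Injective (fderiv ℝ f x)) : IsOpenMap (fun x : W => f x) := by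
  refine IsOpenMap.of_nhds_le fun x => ?_
  have hx := hW.mem_nhds x.2
  have hs : HasStrictFDerivAt f (fderiv ℝ f x) x :=
    (hf.contDiffAt hx).hasStrictFDerivAt (by simp)
  -- In equal dimensions an injective differential is onto.
  have hsurj : (fderiv ℝ f x).range = ⊤ :=
    LinearMap.range_eq_top.2
      ((LinearMap.injective_iff_surjective (f := (fderiv ℝ f x : E n →ₗ[ℝ] E n))).1
        (hinj x x.2))
  have := hs.map_nhds_eq_of_surj hsurj
  rw [← this, ← map_nhds_subtype_coe_eq_nhds x.2 hx, Filter.map_map]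
  rfl

theorem isSmoothEmbeddingOn_of_injOn {n : ℕ} {f : E n → E n} {W : Set (E n)}
    (hW : IsOpen W) (hf : ContDiffOn ℝ ∞ f W)
    (hder : ∀ x ∈ W, Function.Injective (fderiv ℝ f x)) (hinj : Set.InjOn f W) :
    IsSmoothEmbeddingOn f W :=
  ⟨hW, hf, hder, (Topology.IsOpenEmbedding.of_continuous_injective_isOpenMap
    hf.continuousOn.domRestrict hinj.injective
    (isOpenMap_restrict_of_injective_fderiv hW hf hder)).isEmbedding⟩

theorem IsSmoothEmbeddingOn.isOpen_image {n : ℕ} {f : E n → E n} {W : Set (E n)}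
    (h : IsSmoothEmbeddingOn f W) : IsOpen (f '' W) := by
  have := (isOpenMap_restrict_of_injective_fderiv h.isOpen h.contDiffOn
    h.injective_fderiv).isOpen_range
  rwa [show (fun x : W => f x) = W.domRestrict f from rfl, Set.range_domRestrict] at this

/-! ### The differential of the TDOA map -/

theorem continuous_wedge {X : Type*} [TopologicalSpace X] {f g : X → E 2} (hf : Continuous f)
    (hg : Continuous g) : Continuous fun x => wedge (f x) (g x) := by
  unfold wedge
  fun_prop

theorem continuous_disp (r : Fin 3 → E 2) (i : Fin 3) : Continuous (disp r i) := by
  unfold disp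
  fun_prop

theorem disp_ne_zero {r : Fin 3 → E 2} {i : Fin 3} {x : E 2} (h : x ≠ r i) :
    disp r i x ≠ 0 := sub_ne_zero.2 h

theorem hasFDerivAt_norm_disp {r : Fin 3 → E 2} {i : Fin 3} {x : E 2} (h : x ≠ r i) :
    HasFDerivAt (fun y => ‖disp r i y‖) (innerSL ℝ (unitDisp r i x)) x := by
  have hd : HasFDerivAt (disp r i) (ContinuousLinearMap.id ℝ (E 2)) x :=
    (hasFDerivAt_id x).sub_const (r i)
  have h0 : ‖disp r i x‖ ≠ 0 := norm_ne_zero_iff.2 (disp_ne_zero h)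
  have h1 := (hd.norm_sq).sqrt (by simpa using h0)
  have h2 : (fun y => √((‖disp r i ·‖ ^ 2) y)) = fun y => ‖disp r i y‖ := by
    funext y
    exact Real.sqrt_sq (norm_nonneg _)
  rw [h2] at h1
  convert! h1 using 1
  ext v
  simp [unitDisp, Real.sqrt_sq (norm_nonneg (disp r i x))]
  field_simp

theorem contDiffAt_tau {r : Fin 3 → E 2} {x : E 2} (h : ∀ i, x ≠ r i) :
    ContDiffAt ℝ ∞ (tau r) x := by
  have hn : ∀ i, ContDiffAt ℝ ∞ (fun y => ‖disp r i y‖) x := fun i =>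
    (contDiffAt_id.sub contDiffAt_const).norm ℝ (disp_ne_zero (h i))
  rw [contDiffAt_euclidean]
  intro i
  fin_cases i
  · exact (hn 1).sub (hn 0)
  · exact (hn 2).sub (hn 0)

theorem fderiv_tau_apply {r : Fin 3 → E 2} {x : E 2} (h : ∀ i, x ≠ r i) (v : E 2) :
    fderiv ℝ (tau r) x v 0 = inner ℝ (unitDisp r 1 x - unitDisp r 0 x) v ∧
    fderiv ℝ (tau r) x v 1 = inner ℝ (unitDisp r 2 x - unitDisp r 0 x) v := by
  have ht := fun i => (hasStrictFDerivAt_euclidean.1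
    ((contDiffAt_tau h).hasStrictFDerivAt (by simp)) i).hasFDerivAt
  have h1 := (ht 0).unique ((hasFDerivAt_norm_disp (h 1)).sub (hasFDerivAt_norm_disp (h 0)))
  have h2 := (ht 1).unique ((hasFDerivAt_norm_disp (h 2)).sub (hasFDerivAt_norm_disp (h 0)))
  constructor
  · simpa [inner_sub_left] using DFunLike.congr_fun h1 v
  · simpa [inner_sub_left] using DFunLike.congr_fun h2 v

/-- The negative of the Jacobian determinant of the TDOA map. -/
def orient (r : Fin 3 → E 2) (x : E 2) : ℝ :=
  wedge (unitDisp r 1 x) (unitDisp r 0 x) - wedge (unitDisp r 2 x) (unitDisp r 0 x)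
      + wedge (unitDisp r 2 x) (unitDisp r 1 x)

theorem inner_eq (v w : E 2) : inner ℝ v w = v 0 * w 0 + v 1 * w 1 := by
  simp [PiLp.inner_apply, Fin.sum_univ_two, mul_comm]

theorem injective_fderiv_tau {r : Fin 3 → E 2} {x : E 2} (h : ∀ i, x ≠ r i)
    (ho : orient r x ≠ 0) : Function.Injective (fderiv ℝ (tau r) x) := by
  rw [injective_iff_map_eq_zero]
  intro v hv
  obtain ⟨h1, h2⟩ := fderiv_tau_apply h v
  rw [hv, inner_eq] at h1 h2
  simp only [PiLp.zero_apply, PiLp.sub_apply] at h1 h2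
  unfold orient wedge at ho
  ext i
  -- Cramer's rule: the determinant times each coordinate of `v` is a combination of the two
  -- equations.
  refine (mul_eq_zero.1 (?_ : _ * v i = 0)).resolve_left ho
  fin_cases i
  · simp only [Fin.zero_eta]
    linear_combination (unitDisp r 2 x 1 - unitDisp r 0 x 1) * h1
      - (unitDisp r 1 x 1 - unitDisp r 0 x 1) * h2
  · simp only [Fin.mk_one]
    linear_combination -(unitDisp r 2 x 0 - unitDisp r 0 x 0) * h1
      + (unitDisp r 1 x 0 - unitDisp r 0 x 0) * h2

/-! ### Injectivity -/

theorem norm_sq_eq (v : E 2) : ‖v‖ ^ 2 = v 0 ^ 2 + v 1 ^ 2 := by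
  rw [EuclideanSpace.real_norm_sq_eq, Fin.sum_univ_two]

/-- The determinant of the null vectors `(disp r i x, ‖disp r i x‖)` of Minkowski space. -/
theorem orient_mul_norms {r : Fin 3 → E 2} {x : E 2} (h : ∀ i, x ≠ r i) :
    orient r x * (‖disp r 0 x‖ * ‖disp r 1 x‖ * ‖disp r 2 x‖) =
      -(‖disp r 0 x‖ * wedge (disp r 1 x) (disp r 2 x)
        - ‖disp r 1 x‖ * wedge (disp r 0 x) (disp r 2 x)
        + ‖disp r 2 x‖ * wedge (disp r 0 x) (disp r 1 x)) := by
  have h0 : ∀ i, ‖disp r i x‖ ≠ 0 := fun i => norm_ne_zero_iff.2 (disp_ne_zero (h i))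
  have h0' := h0 0
  have h1' := h0 1
  have h2' := h0 2
  simp only [orient, wedge, unitDisp, PiLp.smul_apply, smul_eq_mul]
  field_simp
  ring

theorem eq_of_tau_eq {r : Fin 3 → E 2} (hr : wedge (r 1 - r 0) (r 2 - r 0) ≠ 0) {x y : E 2}
    (hx : ∀ i, x ≠ r i) (hy : ∀ i, y ≠ r i) (ho : 0 < orient r x * orient r y)
    (h : tau r x = tau r y) : x = y := by
  have pos : ∀ z : E 2, (∀ i, z ≠ r i) → 0 < ‖disp r 0 z‖ * ‖disp r 1 z‖ * ‖disp r 2 z‖ := by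
    intro z hz
    have h0 : ∀ i, 0 < ‖disp r i z‖ := fun i => norm_pos_iff.2 (disp_ne_zero (hz i))
    exact mul_pos (mul_pos (h0 0) (h0 1)) (h0 2)
  have px := pos x hx
  have py := pos y hy
  have vx := orient_mul_norms hx
  have vy := orient_mul_norms hy
  set Px := ‖disp r 0 x‖ * ‖disp r 1 x‖ * ‖disp r 2 x‖
  set Py := ‖disp r 0 y‖ * ‖disp r 1 y‖ * ‖disp r 2 y‖
  -- Multiplied by `orient r x`, the sum becomes a nonnegative term plus a positive one.
  have hne : orient r x * Px + orient r y * Py ≠ 0 := by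
    intro h0
    have h1 : orient r x * (orient r x * Px + orient r y * Py) = 0 := by rw [h0, mul_zero]
    nlinarith [mul_pos ho py, mul_nonneg (sq_nonneg (orient r x)) px.le]
  have t1 : ‖disp r 1 x‖ - ‖disp r 0 x‖ = ‖disp r 1 y‖ - ‖disp r 0 y‖ := by
    simpa [tau] using congrArg (fun z : E 2 => z 0) h
  have t2 : ‖disp r 2 x‖ - ‖disp r 0 x‖ = ‖disp r 2 y‖ - ‖disp r 0 y‖ := by
    simpa [tau] using congrArg (fun z : E 2 => z 1) h
  have q := fun (i : Fin 3) (z : E 2) => norm_sq_eq (disp r i z)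
  have qx0 := q 0 x
  have qx1 := q 1 x
  have qx2 := q 2 x
  have qy0 := q 0 y
  have qy1 := q 1 y
  have qy2 := q 2 y
  clear q
  clear_value Px Py
  obtain ⟨s, hs⟩ : ∃ s, s = ‖disp r 0 y‖ - ‖disp r 0 x‖ := ⟨_, rfl⟩
  have s0 : ‖disp r 0 y‖ = ‖disp r 0 x‖ + s := by linarith
  have s1 : ‖disp r 1 y‖ = ‖disp r 1 x‖ + s := by linarith
  have s2 : ‖disp r 2 y‖ = ‖disp r 2 x‖ + s := by linarith
  rw [s0] at qy0 vy
  rw [s1] at qy1 vy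
  rw [s2] at qy2 vy
  clear hs s0 s1 s2 t1 t2 h
  generalize ‖disp r 0 x‖ = n0 at *
  generalize ‖disp r 1 x‖ = n1 at *
  generalize ‖disp r 2 x‖ = n2 at *
  simp only [wedge, disp, PiLp.sub_apply] at *
  -- The quadratic terms cancel between the circle equations of receivers 1 and 0, and likewise for
  -- 2 and 0.
  have g1 : (r 1 0 - r 0 0) * (y 0 - x 0) + (r 1 1 - r 0 1) * (y 1 - x 1) + (n1 - n0) * s = 0 := by
    linear_combination (qy1 - qx1 - qy0 + qx0) / 2
  have g2 : (r 2 0 - r 0 0) * (y 0 - x 0) + (r 2 1 - r 0 1) * (y 1 - x 1) + (n2 - n0) * s = 0 := by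
    linear_combination (qy2 - qx2 - qy0 + qx0) / 2
  -- Cramer's rule on `g1`, `g2` expresses the determinant times `y - x` as a multiple of `s`. This
  -- is substituted into the difference of the two circle equations of receiver 0.
  have hsum : s * (orient r x * Px + orient r y * Py) = 0 := by
    rw [vx, vy]
    linear_combination
      -((x 0 - r 0 0) + (y 0 - r 0 0)) * ((r 2 1 - r 0 1) * g1 - (r 1 1 - r 0 1) * g2)
      + ((x 1 - r 0 1) + (y 1 - r 0 1)) * ((r 2 0 - r 0 0) * g1 - (r 1 0 - r 0 0) * g2)
      - ((r 1 0 - r 0 0) * (r 2 1 - r 0 1) - (r 1 1 - r 0 1) * (r 2 0 - r 0 0)) * (qy0 - qx0)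
  have hs0 : s = 0 := (mul_eq_zero.1 hsum).resolve_right hne
  rw [hs0, mul_zero, add_zero] at g1 g2
  ext i
  refine (sub_eq_zero.1 ((mul_eq_zero.1 (?_ : _ * (y i - x i) = 0)).resolve_left hr)).symm
  fin_cases i
  · simp only [Fin.zero_eta]
    linear_combination (r 2 1 - r 0 1) * g1 - (r 1 1 - r 0 1) * g2
  · simp only [Fin.mk_one]
    linear_combination -(r 2 0 - r 0 0) * g1 + (r 1 0 - r 0 0) * g2

/-- One sign condition serves twice: on the diagonal it makes the Jacobian nonzero, and on pairs it
gives injectivity. -/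
theorem isSmoothEmbeddingOn_tau {r : Fin 3 → E 2} (hr : wedge (r 1 - r 0) (r 2 - r 0) ≠ 0)
    {W : Set (E 2)} (hW : IsOpen W) (hne : ∀ x ∈ W, ∀ i, x ≠ r i)
    (ho : ∀ x ∈ W, ∀ y ∈ W, 0 < orient r x * orient r y) : IsSmoothEmbeddingOn (tau r) W :=
  isSmoothEmbeddingOn_of_injOn hW
    (fun x hx => (contDiffAt_tau (hne x hx)).contDiffWithinAt)
    (fun x hx => injective_fderiv_tau (hne x hx) (left_ne_zero_of_mul (ho x hx x hx).ne'))
    (fun x hx y hy h => eq_of_tau_eq hr (hne x hx) (hne y hy) (ho x hx y hy) h)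

/-! ### The four regions -/

theorem isOpen_Omega (r : Fin 3 → E 2) : IsOpen (Omega r) := by
  have hU : IsOpen {x : E 2 | ∀ i, x ≠ r i} := by
    simp only [Set.ofPred_forall]
    exact isOpen_iInter_of_finite fun i => isOpen_ne
  have hu : ∀ i, ContinuousOn (unitDisp r i) {x : E 2 | ∀ i, x ≠ r i} := fun i =>
    ((continuous_disp r i).norm.continuousOn.inv₀
      fun x (hx : ∀ i, x ≠ r i) => norm_ne_zero_iff.2 (disp_ne_zero (hx i))).smul
      (continuous_disp r i).continuousOn
  have hc : ∀ i j, ContinuousOn (fun x => wedge (unitDisp r i x) (unitDisp r j x))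
      {x : E 2 | ∀ i, x ≠ r i} := fun i j =>
    (continuous_wedge continuous_fst continuous_snd).comp_continuousOn ((hu i).prodMk (hu j))
  exact (((hc 1 0).sub (hc 2 0)).add (hc 2 1)).isOpen_inter_preimage hU isOpen_Iio

theorem isOpen_wedge_lt (r : Fin 3 → E 2) (i j : Fin 3) :
    IsOpen {x | wedge (disp r i x) (disp r j x) < 0} :=
  isOpen_lt (continuous_wedge (continuous_disp r i) (continuous_disp r j)) continuous_const

theorem isOpen_lt_wedge (r : Fin 3 → E 2) (i j : Fin 3) :
    IsOpen {x | 0 < wedge (disp r i x) (disp r j x)} :=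
  isOpen_lt continuous_const (continuous_wedge (continuous_disp r i) (continuous_disp r j))

theorem wedge_swap (v w : E 2) : wedge v w = -wedge w v := by
  unfold wedge
  ring

theorem ne_of_wedge_pos {r : Fin 3 → E 2} {i j : Fin 3} {x : E 2}
    (h : 0 < wedge (disp r i x) (disp r j x)) : x ≠ r i ∧ x ≠ r j := by
  constructor <;> rintro rfl <;> simp [wedge, disp] at h

theorem norm_unitDisp {r : Fin 3 → E 2} {i : Fin 3} {x : E 2} (h : x ≠ r i) :
    ‖unitDisp r i x‖ = 1 := by
  simp [unitDisp, norm_smul, norm_ne_zero_iff.2 (disp_ne_zero h)]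

theorem wedge_unitDisp_pos {r : Fin 3 → E 2} {i j : Fin 3} {x : E 2}
    (h : 0 < wedge (disp r i x) (disp r j x)) : 0 < wedge (unitDisp r i x) (unitDisp r j x) := by
  obtain ⟨hi, hj⟩ := ne_of_wedge_pos h
  have h1 := norm_pos_iff.2 (disp_ne_zero hi)
  have h2 := norm_pos_iff.2 (disp_ne_zero hj)
  have : wedge (unitDisp r i x) (unitDisp r j x) =
      ‖disp r i x‖⁻¹ * ‖disp r j x‖⁻¹ * wedge (disp r i x) (disp r j x) := by
    simp only [wedge, unitDisp, PiLp.smul_apply, smul_eq_mul]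
    ring
  rw [this]
  positivity

/-- The inequality `sin (α + β) < sin α + sin β` for `α`, `β` in `(0, π)`. -/
theorem wedge_lt_wedge_add_wedge {u v w : E 2} (hu : ‖u‖ = 1) (hv : ‖v‖ = 1) (hw : ‖w‖ = 1)
    (huv : 0 < wedge u v) (hvw : 0 < wedge v w) : wedge u w < wedge u v + wedge v w := by
  have su := norm_sq_eq u
  have sv := norm_sq_eq v
  have sw := norm_sq_eq w
  rw [hu] at su
  rw [hv] at sv
  rw [hw] at sw
  unfold wedge at *
  -- The addition formula for the sine, with `v` as the intermediate direction.
  have key : u 0 * w 1 - u 1 * w 0 =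
      (u 0 * v 1 - u 1 * v 0) * (v 0 * w 0 + v 1 * w 1) +
        (v 0 * w 1 - v 1 * w 0) * (u 0 * v 0 + u 1 * v 1) := by
    linear_combination (u 0 * w 1 - u 1 * w 0) * sv
  -- The cosine is below 1 because the sine is nonzero.
  have c1 : v 0 * w 0 + v 1 * w 1 < 1 := by
    have := pow_pos hvw 2
    nlinarith
  have c2 : u 0 * v 0 + u 1 * v 1 < 1 := by
    have := pow_pos huv 2
    nlinarith
  rw [key]
  nlinarith [mul_pos huv (sub_pos.2 c1), mul_pos hvw (sub_pos.2 c2)]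

/-- Each of `Omega0`, `Omega1`, `Omega2` supplies the two hypotheses for one cyclic rotation of the
order 0, 2, 1, namely the one whose middle index `j` is that of the region. The conclusion is then
`0 < orient r x`, up to antisymmetry of `wedge`. -/
theorem wedge_unitDisp_lt {r : Fin 3 → E 2} {i j k : Fin 3} {x : E 2}
    (hij : 0 < wedge (disp r i x) (disp r j x)) (hjk : 0 < wedge (disp r j x) (disp r k x)) :
    wedge (unitDisp r i x) (unitDisp r k x) <
      wedge (unitDisp r i x) (unitDisp r j x) + wedge (unitDisp r j x) (unitDisp r k x) :=
  wedge_lt_wedge_add_wedge (norm_unitDisp (ne_of_wedge_pos hij).1)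
    (norm_unitDisp (ne_of_wedge_pos hij).2) (norm_unitDisp (ne_of_wedge_pos hjk).2)
    (wedge_unitDisp_pos hij) (wedge_unitDisp_pos hjk)

theorem isSmoothEmbeddingOn_tau_Omega {r : Fin 3 → E 2}
    (hr : wedge (r 1 - r 0) (r 2 - r 0) ≠ 0) : IsSmoothEmbeddingOn (tau r) (Omega r) :=
  isSmoothEmbeddingOn_tau hr (isOpen_Omega r) (fun _ hx => hx.1)
    (fun _ hx _ hy => mul_pos_of_neg_of_neg hx.2 hy.2)

theorem isSmoothEmbeddingOn_tau_Omega0 {r : Fin 3 → E 2}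
    (hr : wedge (r 1 - r 0) (r 2 - r 0) ≠ 0) : IsSmoothEmbeddingOn (tau r) (Omega0 r) := by
  have key : ∀ x ∈ Omega0 r, (∀ i, x ≠ r i) ∧ 0 < orient r x := by
    rintro x ⟨h1, h2⟩
    rw [wedge_swap, neg_lt_zero] at h2
    refine ⟨Fin.forall_fin_succ.2 ⟨(ne_of_wedge_pos h1).2, Fin.forall_fin_two.2
      ⟨(ne_of_wedge_pos h1).1, (ne_of_wedge_pos h2).2⟩⟩, ?_⟩
    have := wedge_unitDisp_lt h1 h2
    unfold orient
    rw [wedge_swap (unitDisp r 2 x), wedge_swap (unitDisp r 2 x)]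
    linarith
  exact isSmoothEmbeddingOn_tau hr ((isOpen_lt_wedge r 1 0).inter (isOpen_wedge_lt r 2 0))
    (fun x hx => (key x hx).1) (fun x hx y hy => mul_pos (key x hx).2 (key y hy).2)

theorem isSmoothEmbeddingOn_tau_Omega1 {r : Fin 3 → E 2}
    (hr : wedge (r 1 - r 0) (r 2 - r 0) ≠ 0) : IsSmoothEmbeddingOn (tau r) (Omega1 r) := by
  have key : ∀ x ∈ Omega1 r, (∀ i, x ≠ r i) ∧ 0 < orient r x := by
    rintro x ⟨h1, h2⟩
    refine ⟨Fin.forall_fin_succ.2 ⟨(ne_of_wedge_pos h1).2, Fin.forall_fin_two.2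
      ⟨(ne_of_wedge_pos h1).1, (ne_of_wedge_pos h2).1⟩⟩, ?_⟩
    have := wedge_unitDisp_lt h2 h1
    unfold orient
    linarith
  exact isSmoothEmbeddingOn_tau hr ((isOpen_lt_wedge r 1 0).inter (isOpen_lt_wedge r 2 1))
    (fun x hx => (key x hx).1) (fun x hx y hy => mul_pos (key x hx).2 (key y hy).2)

theorem isSmoothEmbeddingOn_tau_Omega2 {r : Fin 3 → E 2}
    (hr : wedge (r 1 - r 0) (r 2 - r 0) ≠ 0) : IsSmoothEmbeddingOn (tau r) (Omega2 r) := by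
  have key : ∀ x ∈ Omega2 r, (∀ i, x ≠ r i) ∧ 0 < orient r x := by
    rintro x ⟨h1, h2⟩
    rw [wedge_swap, neg_lt_zero] at h1
    refine ⟨Fin.forall_fin_succ.2 ⟨(ne_of_wedge_pos h1).1, Fin.forall_fin_two.2
      ⟨(ne_of_wedge_pos h2).2, (ne_of_wedge_pos h2).1⟩⟩, ?_⟩
    have := wedge_unitDisp_lt h1 h2
    unfold orient
    rw [wedge_swap (unitDisp r 1 x), wedge_swap (unitDisp r 2 x) (unitDisp r 0 x)]
    linarith
  exact isSmoothEmbeddingOn_tau hr ((isOpen_wedge_lt r 2 0).inter (isOpen_lt_wedge r 2 1))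
    (fun x hx => (key x hx).1) (fun x hx y hy => mul_pos (key x hx).2 (key y hy).2)

end TDOA

end

theorem mainTheorem3 (r : Fin 3 → TDOA.E 2)
    (hr : 0 < TDOA.wedge (r 1 - r 0) (r 2 - r 0))
    (K : Matrix (Fin 2) (Fin 2) ℝ) (hK : K.PosDef) :
    ∃ S : TDOA.ExponentialFamily (TDOA.E 2) MeasureTheory.volume 2,
      S.Θ = Set.univ ∧ (∀ θ : TDOA.E 2, S.density θ = TDOA.normalDensity K θ) ∧
      ∀ W : Set (TDOA.E 2),
        (W = TDOA.Omega r ∨ W = TDOA.Omega0 r ∨ W = TDOA.Omega1 r ∨ W = TDOA.Omega2 r) →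
        S.IsCurvedExponentialFamily 2 (TDOA.restrictedModel r K W) ∧
        S.IsParametrizedBy W (TDOA.modelDensity r K) (TDOA.tau r) := by
  refine ⟨TDOA.normalFamily hK, rfl, TDOA.normalFamily_density hK, fun W hW => ?_⟩
  have hemb : TDOA.IsSmoothEmbeddingOn (TDOA.tau r) W := by
    rcases hW with rfl | rfl | rfl | rfl
    · exact TDOA.isSmoothEmbeddingOn_tau_Omega hr.ne'
    · exact TDOA.isSmoothEmbeddingOn_tau_Omega0 hr.ne'
    · exact TDOA.isSmoothEmbeddingOn_tau_Omega1 hr.ne'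
    · exact TDOA.isSmoothEmbeddingOn_tau_Omega2 hr.ne'
  have hdens : ∀ x, TDOA.modelDensity r K x = (TDOA.normalFamily hK).density (TDOA.tau r x) :=
    fun x => (TDOA.normalFamily_density hK _).symm
  refine ⟨⟨?_, ?_⟩, fun x _ => ⟨Set.mem_univ _, hdens x⟩, hemb⟩
  · rintro _ ⟨x, _, rfl⟩
    exact ⟨TDOA.tau r x, Set.mem_univ _, (hdens x).symm⟩
  -- Since the density determines its mean, the model in the coordinate θ is exactly the image of
  -- `W`, an open set.
  · have himage : {θ : TDOA.E 2 | θ ∈ (TDOA.normalFamily hK).Θ ∧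
        (TDOA.normalFamily hK).density θ ∈ TDOA.restrictedModel r K W} = TDOA.tau r '' W := by
      ext θ
      constructor
      · rintro ⟨_, x, hx, h⟩
        rw [TDOA.normalFamily_density] at h
        exact ⟨x, hx, TDOA.normalDensity_injective hK h⟩
      · rintro ⟨x, hx, rfl⟩
        exact ⟨Set.mem_univ _, x, hx, hdens x⟩
    rw [himage]
    exact TDOA.isSmoothSubmanifold_of_isOpen hemb.isOpen_image
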